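/- **Soundness of D'.EAK with respect to the final coalgebra semantics.** *Language.* Fix a set $\mathsf{AtProp}$ of atomic propositions and a set $\mathsf{Ag}$ of agents. The EAK-formulas $A ::= p \mid \neg A\mid A\vee A\mid \langle a\rangle A\mid\langle\alpha\rangle A$ and the action structures $\alpha=(K,k,(\alpha_a)_{a\in\mathsf{Ag}},Pre_\alpha)$ ($K$ finite, $k\in K$, $\alpha_a\subseteq K\times K$, $Pre_\alpha$ a map from $K$ to EAK-formulas) are defined simultaneously; $Pre(\alpha):=Pre_\alpha(k)$, $\alpha_i$ is $\alpha$ with designated state $i$, and $\alpha a\beta$ means $\beta=\alpha_i$ for some $i$ with $k\,\alpha_a\,i$. Formulas of D'.EAK are built from atoms, $\bot$, $\top$ and constants $1_\alpha$ by $\wedge,\vee,\to,\leftarrow$, the binary connectives $A\rightarrowtail B$ and $B\leftarrowtail A$, the modalities $\langle a\rangle,[a]$ and $\langle\alpha\rangle,[\alpha]$, and their adjoints $\langle \bar a\rangle,[\bar a]$, $\langle\bar\alpha\rangle,[\bar\alpha]$. Structures are built from these formulas, $\mathrm I$ and $\Phi_\alpha$ by $X;Y$, $X>Y$, $X<Y$,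 $\{a\}X$, $\{\bar a\}X$, $\{\alpha\}X$, $\{\bar\alpha\}X$. A sequent $X\vdash Y$ is a pair of structures. *Semantics.* In a Kripke model $M=(W,(R_a)_{a},V)$ EAK-formulas have their usual extensions, with $M,w\Vdash\langle\alpha\rangle A$ iff $M,w\Vdash Pre(\alpha)$ and $M^\alpha,(w,k)\Vdash A$, where the update $M^\alpha$ has domain $\{(w,j)\in W\times K\mid M,w\Vdash Pre_\alpha(j)\}$, relations $(w,i)R^\alpha_a(u,j)$ iff $wR_au$ and $i\,\alpha_a\,j$, and the valuation inherited from $M$. Let $\mathbb Z$ be the final coalgebra of Kripke models, i.e. the disjoint union of all Kripke models modulo bisimilarity. An action $\alpha$ is interpreted by the relation $\alpha_{\mathbb Z}$ on $\mathbb Z$ such that $z\,\alpha_{\mathbb Z}\,z'$ iff there is a pointed model $(M,w)$ with $M,w\Vdash Pre(\alpha)$ such that the unique morphisms $M\to\mathbb Z$ and $M^\alpha\to\mathbb Z$ map $w$ to $z$ and $(w,k)$ to $z'$. D'.EAK-formulas are interpreted as subsets of $\mathbb Z$: propositional connectives classically, with $[\![ B\leftarrow A]\!]=[\![ A\to B]\!]$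 and $[\![ A\rightarrowtail B]\!]=[\![ B\leftarrowtail A]\!]=[\![ B]\!]\setminus[\![ A]\!]$; $\langle a\rangle,[a]$ (resp. $\langle\alpha\rangle,[\alpha]$) as diamond and box of the relation $R_a$ of $\mathbb Z$ (resp. of $\alpha_{\mathbb Z}$), their adjoints as diamond and box of the converse relation; and $[\![ 1_\alpha]\!]_{\mathbb Z}=[\![ Pre(\alpha)]\!]_{\mathbb Z}$. Structures are translated into formulas according to their position, where the left-hand side of a sequent is in precedent and the right-hand side in succedent position, the first argument of $>$ and the second argument of $<$ switch position, and all other arguments keep it. In precedent (resp. succedent) position $\mathrm I$ is read as $\top$ ($\bot$), $;$ as $\wedge$ ($\vee$), $X>Y$ as $X\rightarrowtail Y$ ($X\to Y$), $X<Y$ as $X\leftarrowtail Y$ ($X\leftarrow Y$), and each modal proxy as the corresponding diamond (box). $\Phi_\alpha$ is read as $1_\alpha$ in precedent position; it is not meant to occur in succedent position, and an arbitrary formula may be chosen as its reading there. A sequent $X\vdash Y$ holds in $\mathbb Z$ if $[\![ X]\!]_{\mathbb Z}\subseteq[\![ Y]\!]_{\mathbb Z}$. *Rules of D'.EAK* (written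 premises $/$ conclusion; $//$ means both directions; $A,B$ are formulas, $X,Y,Z,W$ structures). - Propositional structural rules: $p\vdash p$; Cut $X\vdash A,\ A\vdash Y/X\vdash Y$; $X\vdash Y//\mathrm I\vdash Y<X$; $X\vdash Y//X<Y\vdash\mathrm I$; $X\vdash Y//\mathrm I\vdash X>Y$; $X\vdash Y//Y>X\vdash\mathrm I$; $\mathrm I\vdash X/Y\vdash X$; $X\vdash\mathrm I/X\vdash Y$; weakening $X\vdash Z/Y\vdash Z<X$, $X\vdash Z/X<Z\vdash Y$, $X\vdash Z/Y\vdash X>Z$, $X\vdash Z/Z>X\vdash Y$; contraction $X;X\vdash Y/X\vdash Y$, $Y\vdash X;X/Y\vdash X$; exchange $Y;X\vdash Z/X;Y\vdash Z$, $Z\vdash X;Y/Z\vdash Y;X$; associativity $X;(Y;Z)\vdash W/(X;Y);Z\vdash W$, $W\vdash(Z;Y);X/W\vdash Z;(Y;X)$; display postulates $X;Y\vdash Z//X\vdash Z<Y$, $Z\vdash X;Y//Z<Y\vdash X$, $X;Y\vdash Z//Y\vdash X>Z$, $Z\vdash X;Y//X>Z\vdash Y$; Grishin $X>(Y;Z)\vdash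 W//(X>Y);Z\vdash W$, $W\vdash X>(Y;Z)//W\vdash(X>Y);Z$. - Propositional operational rules: $\bot\vdash\mathrm I$; $X\vdash\mathrm I/X\vdash\bot$; $\mathrm I\vdash X/\top\vdash X$; $\mathrm I\vdash\top$; $A;B\vdash Z/A\wedge B\vdash Z$; $X\vdash A,\ Y\vdash B/X;Y\vdash A\wedge B$; $A\vdash X,\ B\vdash Y/A\vee B\vdash X;Y$; $Z\vdash A;B/Z\vdash A\vee B$; $B\vdash Y,\ X\vdash A/B\leftarrow A\vdash Y<X$; $Z\vdash B<A/Z\vdash B\leftarrow A$; $B<A\vdash Z/B\leftarrowtail A\vdash Z$; $Y\vdash B,\ A\vdash X/Y<X\vdash B\leftarrowtail A$; $X\vdash A,\ B\vdash Y/A\to B\vdash X>Y$; $Z\vdash A>B/Z\vdash A\to B$; $A>B\vdash Z/A\rightarrowtail B\vdash Z$; $A\vdash X,\ Y\vdash B/X>Y\vdash A\rightarrowtail B$. - For each modal proxy $\{m\}\in\{\{a\},\{\bar a\},\{\alpha\},\{\bar\alpha\}\}$, with diamond $\langle m\rangle$ and box $[m]$: $\mathrm I\vdash X/\{m\}\mathrm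 I\vdash X$; $X\vdash\mathrm I/X\vdash\{m\}\mathrm I$; $\{m\}Y>\{m\}Z\vdash X/\{m\}(Y>Z)\vdash X$; $Y\vdash\{m\}X>\{m\}Z/Y\vdash\{m\}(X>Z)$; $\{m\}X;\{m\}Y\vdash Z/\{m\}(X;Y)\vdash Z$; $Z\vdash\{m\}Y;\{m\}X/Z\vdash\{m\}(Y;X)$; $\{m\}A\vdash X/\langle m\rangle A\vdash X$; $X\vdash A/\{m\}X\vdash\langle m\rangle A$; $A\vdash X/[m]A\vdash\{m\}X$; $X\vdash\{m\}A/X\vdash[m]A$. Display postulates, for $m=a$ and $m=\alpha$: $\{m\}X\vdash Y//X\vdash\{\bar m\}Y$ and $X\vdash\{m\}Y//\{\bar m\}X\vdash Y$. - Rules for epistemic actions: *atom* $\Gamma p\vdash\Delta p$, where $\Gamma,\Delta$ are finite sequences of proxies $\{\alpha\}$, $\{\bar\alpha\}$; *balance* $X\vdash Y/\{\alpha\}X\vdash\{\alpha\}Y$; *comp* $\{\alpha\}\{\bar\alpha\}X\vdash Y/\Phi_\alpha;X\vdash Y$ and $X\vdash\{\alpha\}\{\bar\alpha\}Y/X\vdash\Phi_\alpha>Y$;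 *reduce'* $\Phi_\alpha;\{\alpha\}X\vdash Y/\{\alpha\}X\vdash Y$ and $Y\vdash\Phi_\alpha>\{\alpha\}X/Y\vdash\{\alpha\}X$; *swap-in'*, for every $\beta$ with $\alpha a\beta$: $\{\alpha\}\{a\}X\vdash Y/\Phi_\alpha;\{a\}\{\beta\}X\vdash Y$ and $Y\vdash\{\alpha\}\{a\}X/Y\vdash\Phi_\alpha>\{a\}\{\beta\}X$; *swap-out'* $(\{a\}\{\beta\}X\vdash Y\mid\alpha a\beta)/\{\alpha\}\{a\}X\vdash Y^{(n)}$ and $(Y\vdash\{a\}\{\beta\}X\mid\alpha a\beta)/Y^{(n)}\vdash\{\alpha\}\{a\}X$, where $n=|\{\beta\mid\alpha a\beta\}|$, $Y^{(n)}=(\cdots(Y;Y);\cdots;Y)$ with $n$ occurrences of $Y$, and $Y^{(0)}=\mathrm I$; $\Phi_\alpha\vdash X/1_\alpha\vdash X$; $\Phi_\alpha\vdash1_\alpha$. **Theorem.** Every rule of D'.EAK is sound with respect to the final coalgebra semantics: for every instance of a rule, if all premises hold in $\mathbb Z$, then the conclusion holds in $\mathbb Z$. Consequently, every sequent derivable in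 D'.EAK holds in $\mathbb Z$. -/

import Mathlib

universe u v w w'

namespace EAK

/-! ## Formulas and action structures of EAK -/

mutual

/-- The formulas `A ::= p | ¬A | A ∨ A | ⟨a⟩A | ⟨α⟩A` of the logic of epistemic actions and
knowledge, over agents `Ag` and atomic propositions `AtProp`. -/
inductive Formula (Ag : Type u) (AtProp : Type v) : Type (max u v)
  | atom (p : AtProp)
  | neg (A : Formula Ag AtProp)
  | or (A B : Formula Ag AtProp)
  | dia (a : Ag) (A : Formula Ag AtProp)
  | act (α : Action Ag AtProp) (A : Formula Ag AtProp)

/-- Action structures `(K, k, (α_a)_a, Pre_α)`, where `K` is the finite set `Fin n`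
(nonempty because it contains the designated state `k`). -/
inductive Action (Ag : Type u) (AtProp : Type v) : Type (max u v)
  | mk (n : ℕ) (k : Fin n) (rel : Ag → Fin n → Fin n → Prop) (pre : Fin n → Formula Ag AtProp)

end

section Models

variable {Ag : Type u} {AtProp : Type v}

namespace Action

/-- The number of action states. -/
def size : Action Ag AtProp → ℕ
  | mk n _ _ _ => n

/-- The designated state `k`. -/
def point : (α : Action Ag AtProp) → Fin α.size
  | mk _ k _ _ => k

/-- The relation `α_a` on action states. -/
def rel : (α : Action Ag AtProp) → Ag → Fin α.size → Fin α.size → Prop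
  | mk _ _ r _ => r

/-- The precondition map `Pre_α`. -/
def preAt : (α : Action Ag AtProp) → Fin α.size → Formula Ag AtProp
  | mk _ _ _ pre => pre

/-- `Pre(α) = Pre_α(k)`. -/
def pre (α : Action Ag AtProp) : Formula Ag AtProp := α.preAt α.point

/-- The action structure `α_i`, which differs from `α` in having `i` as its designated state. -/
def withPoint (α : Action Ag AtProp) (i : Fin α.size) : Action Ag AtProp :=
  mk α.size i α.rel α.preAt

/-- `α a β`: the action `β` is one of the `α_i` with `k α_a i`. -/
def Sees (α : Action Ag AtProp) (a : Ag) (β : Action Ag AtProp) : Prop :=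
  ∃ i, α.rel a α.point i ∧ β = α.withPoint i

end Action

/-! ## Kripke models, updates, satisfaction -/

/-- Kripke models, i.e. coalgebras `W → (𝒫 W)^Ag × 2^AtProp`. The empty model is not excluded,
since an update may be empty. -/
structure Model (Ag : Type u) (AtProp : Type v) where
  W : Type w
  R : Ag → W → W → Prop
  V : AtProp → Set W

/-- The submodel of the `n`-fold coproduct of `M` (with relations `R_a × r_a`) on the pairs
`(x, j)` with `x ∈ S j`. -/
def Model.product (M : Model.{u, v, w} Ag AtProp) {n : ℕ} (r : Ag → Fin n → Fin n → Prop)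
    (S : Fin n → Set M.W) : Model.{u, v, w} Ag AtProp where
  W := {x : M.W × Fin n // x.1 ∈ S x.2}
  R a x y := M.R a x.1.1 y.1.1 ∧ r a x.1.2 y.1.2
  V p := {x | x.1.1 ∈ M.V p}

/-- The extension `⟦A⟧_M` of an EAK-formula in a Kripke model. -/
def Formula.ext : Formula Ag AtProp → (M : Model.{u, v, w} Ag AtProp) → Set M.W
  | .atom p, M => M.V p
  | .neg A, M => (A.ext M)ᶜ
  | .or A B, M => A.ext M ∪ B.ext M
  | .dia a A, M => {x | ∃ y, M.R a x y ∧ y ∈ A.ext M}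
  | .act (.mk _ k r pre) A, M =>
      {x | ∃ h : x ∈ (pre k).ext M,
        (⟨(x, k), h⟩ : (M.product r fun j => (pre j).ext M).W) ∈
          A.ext (M.product r fun j => (pre j).ext M)}

/-- The update `M^α`. -/
def Model.update (M : Model.{u, v, w} Ag AtProp) (α : Action Ag AtProp) :
    Model.{u, v, w} Ag AtProp :=
  M.product α.rel fun j => (α.preAt j).ext M

/-! ## The final coalgebra -/

/-- Bisimulations between Kripke models. -/
structure IsBisimulation (M : Model.{u, v, w} Ag AtProp) (N : Model.{u, v, w'} Ag AtProp)
    (B : M.W → N.W → Prop) : Prop where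
  atom : ∀ x y, B x y → ∀ p, x ∈ M.V p ↔ y ∈ N.V p
  forth : ∀ x y, B x y → ∀ a x', M.R a x x' → ∃ y', N.R a y y' ∧ B x' y'
  back : ∀ x y, B x y → ∀ a y', N.R a y y' → ∃ x', M.R a x x' ∧ B x' y'

/-- Coalgebra morphisms, i.e. p-morphisms. -/
structure IsMorphism (M : Model.{u, v, w} Ag AtProp) (N : Model.{u, v, w'} Ag AtProp)
    (f : M.W → N.W) : Prop where
  atom : ∀ x p, x ∈ M.V p ↔ f x ∈ N.V p
  forth : ∀ x a x', M.R a x x' → N.R a (f x) (f x')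
  back : ∀ x a y, N.R a (f x) y → ∃ x', M.R a x x' ∧ f x' = y

/-- Pointed Kripke models with carrier in `Type w`. -/
abbrev Pointed (Ag : Type u) (AtProp : Type v) := Σ M : Model.{u, v, w} Ag AtProp, M.W

/-- Bisimilarity of pointed models. -/
def Bisimilar (x y : Pointed.{u, v, w} Ag AtProp) : Prop :=
  ∃ B, IsBisimulation x.1 y.1 B ∧ B x.2 y.2

theorem bisimilar_equivalence : Equivalence (Bisimilar (Ag := Ag) (AtProp := AtProp)) where
  refl x := ⟨Eq, ⟨by rintro _ _ rfl p; rfl, by rintro x _ rfl a x' h; exact ⟨x', h, rfl⟩,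
    by rintro x _ rfl a x' h; exact ⟨x', h, rfl⟩⟩, rfl⟩
  symm := by
    rintro x y ⟨B, hB, h⟩
    exact ⟨fun s t => B t s, ⟨fun s t k p => (hB.atom _ _ k p).symm,
      fun s t k => hB.back _ _ k, fun s t k => hB.forth _ _ k⟩, h⟩
  trans := by
    rintro x y z ⟨B, hB, h⟩ ⟨C, hC, k⟩
    refine ⟨fun s t => ∃ m, B s m ∧ C m t, ⟨?_, ?_, ?_⟩, y.2, h, k⟩
    · rintro s t ⟨m, h1, h2⟩ p
      exact (hB.atom _ _ h1 p).trans (hC.atom _ _ h2 p)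
    · rintro s t ⟨m, h1, h2⟩ a s' hs
      obtain ⟨m', hm, h1'⟩ := hB.forth _ _ h1 a s' hs
      obtain ⟨t', ht, h2'⟩ := hC.forth _ _ h2 a m' hm
      exact ⟨t', ht, m', h1', h2'⟩
    · rintro s t ⟨m, h1, h2⟩ a t' ht
      obtain ⟨m', hm, h2'⟩ := hC.back _ _ h2 a t' ht
      obtain ⟨s', hs, h1'⟩ := hB.back _ _ h1 a m' hm
      exact ⟨s', hs, m', h1', h2'⟩

/-- The setoid of bisimilarity. -/
def bisimSetoid (Ag : Type u) (AtProp : Type v) : Setoid (Pointed.{u, v, w} Ag AtProp) :=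
  ⟨Bisimilar, bisimilar_equivalence⟩

/-- The carrier of the final coalgebra: points of Kripke models (with carrier in `Type w`)
up to bisimilarity. -/
def FinalCarrier (Ag : Type u) (AtProp : Type v) : Type (max u v (w + 1)) :=
  Quotient (bisimSetoid.{u, v, w} Ag AtProp)

/-- The map from a Kripke model to the final coalgebra. -/
def beh (M : Model.{u, v, w} Ag AtProp) (x : M.W) : FinalCarrier.{u, v, w} Ag AtProp :=
  Quotient.mk _ ⟨M, x⟩

/-- The final coalgebra `ℤ`: the disjoint union of all Kripke models, quotiented by
bisimilarity. -/
abbrev finalModel (Ag : Type u) (AtProp : Type v) : Model.{u, v, max u v (w + 1)} Ag AtProp where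
  W := FinalCarrier.{u, v, w} Ag AtProp
  R a z z' := ∃ (M : Model.{u, v, w} Ag AtProp) (x x' : M.W),
    M.R a x x' ∧ beh M x = z ∧ beh M x' = z'
  V p := {z | ∃ (M : Model.{u, v, w} Ag AtProp) (x : M.W), x ∈ M.V p ∧ beh M x = z}

theorem beh_eq_iff {M N : Model.{u, v, w} Ag AtProp} {x : M.W} {y : N.W} :
    beh M x = beh N y ↔ Bisimilar (⟨M, x⟩ : Pointed.{u, v, w} Ag AtProp) ⟨N, y⟩ :=
  Quotient.eq (r := bisimSetoid.{u, v, w} Ag AtProp)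

/-- The map `beh M` is a coalgebra morphism. -/
theorem beh_isMorphism (M : Model.{u, v, w} Ag AtProp) :
    IsMorphism M (finalModel.{u, v, w} Ag AtProp) (beh M) where
  atom x p := by
    refine ⟨fun h => ⟨M, x, h, rfl⟩, ?_⟩
    rintro ⟨N, y, hy, h⟩
    obtain ⟨B, hB, hb⟩ := beh_eq_iff.1 h
    exact (hB.atom _ _ hb p).1 hy
  forth x a x' h := ⟨M, x, x', h, rfl, rfl⟩
  back x a z := by
    rintro ⟨N, y, y', hy, h, rfl⟩
    obtain ⟨B, hB, hb⟩ := beh_eq_iff.1 h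
    obtain ⟨x', hx, hb'⟩ := hB.forth _ _ hb a y' hy
    have e : beh N y' = beh M x' := beh_eq_iff.2 ⟨B, hB, hb'⟩
    exact ⟨x', hx, e.symm⟩

/-- Finality: `beh M` is the only coalgebra morphism from `M` to the final coalgebra. -/
theorem finalModel_isFinal (M : Model.{u, v, w} Ag AtProp) :
    ∃! f : M.W → (finalModel.{u, v, w} Ag AtProp).W,
      IsMorphism M (finalModel.{u, v, w} Ag AtProp) f := by
  refine ⟨beh M, beh_isMorphism M, fun f hf => funext fun x => ?_⟩
  obtain ⟨⟨N, y⟩, hy⟩ := Quotient.exists_rep (f x)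
  have hy : beh N y = f x := hy
  have hN := beh_isMorphism N
  refine hy.symm.trans (beh_eq_iff.2 ?_)
  refine ⟨fun t s => beh N t = f s, ⟨?_, ?_, ?_⟩, hy⟩
  · intro t s h p
    rw [hN.atom t p, h, ← hf.atom s p]
  · intro t s h a t' ht
    obtain ⟨s', hs, e⟩ := hf.back s a (beh N t') (h ▸ hN.forth t a t' ht)
    exact ⟨s', hs, e.symm⟩
  · intro t s h a s' hs
    exact hN.back t a (f s') (h ▸ hf.forth s a s' hs)

/-- The interpretation `α_ℤ` of an action on the final coalgebra: `z α_ℤ z'` iff there is a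
pointed model `(M, x)` with `M, x ⊩ Pre(α)` such that the morphisms `M → ℤ` and `M^α → ℤ` map
`x` to `z` and `(x, k)` to `z'`. -/
def actionRel (α : Action Ag AtProp) (z z' : FinalCarrier.{u, v, w} Ag AtProp) : Prop :=
  ∃ (M : Model.{u, v, w} Ag AtProp) (x : M.W) (h : x ∈ α.pre.ext M),
    beh M x = z ∧ beh (M.update α) ⟨(x, α.point), h⟩ = z'

end Models

/-! ## Modal operators of a relation -/

section Operators

variable {X : Type u} {Y : Type v}

/-- `⟨R⟩ U`. -/
def fDia (R : X → Y → Prop) (U : Set Y) : Set X := {x | ∃ y, R x y ∧ y ∈ U}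

/-- `[R] U`. -/
def fBox (R : X → Y → Prop) (U : Set Y) : Set X := {x | ∀ y, R x y → y ∈ U}

/-- `⟨R⁻¹⟩ U`. -/
def pDia (R : X → Y → Prop) (U : Set X) : Set Y := {y | ∃ x, R x y ∧ x ∈ U}

/-- `[R⁻¹] U`. -/
def pBox (R : X → Y → Prop) (U : Set X) : Set Y := {y | ∀ x, R x y → x ∈ U}

end Operators

/-! ## The language of D'.EAK -/

/-- Formulas of D'.EAK. -/
inductive Fm (Ag : Type u) (AtProp : Type v) : Type (max u v)
  | atom (p : AtProp)
  | bot
  | top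
  | and (A B : Fm Ag AtProp)
  | or (A B : Fm Ag AtProp)
  /-- `A → B` -/
  | imp (A B : Fm Ag AtProp)
  /-- `B ← A` -/
  | pmi (B A : Fm Ag AtProp)
  /-- `A ⤚ B`, the left residual of disjunction that `>` stands for in precedent position
  (`B` and not `A`) -/
  | rsub (A B : Fm Ag AtProp)
  /-- `B ⤙ A`, which `<` stands for in precedent position (`B` and not `A`) -/
  | lsub (B A : Fm Ag AtProp)
  /-- `⟨a⟩A`, `[a]A` and their adjoints -/
  | agDia (a : Ag) (A : Fm Ag AtProp)
  | agBox (a : Ag) (A : Fm Ag AtProp)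
  | agConvDia (a : Ag) (A : Fm Ag AtProp)
  | agConvBox (a : Ag) (A : Fm Ag AtProp)
  /-- `⟨α⟩A`, `[α]A` and their adjoints -/
  | actDia (α : Action Ag AtProp) (A : Fm Ag AtProp)
  | actBox (α : Action Ag AtProp) (A : Fm Ag AtProp)
  | actConvDia (α : Action Ag AtProp) (A : Fm Ag AtProp)
  | actConvBox (α : Action Ag AtProp) (A : Fm Ag AtProp)
  /-- `1_α` -/
  | one (α : Action Ag AtProp)

/-- Structures of D'.EAK. -/
inductive Struct (Ag : Type u) (AtProp : Type v) : Type (max u v)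
  | fm (A : Fm Ag AtProp)
  | I
  /-- `X ; Y` -/
  | semi (X Y : Struct Ag AtProp)
  /-- `X > Y` -/
  | gt (X Y : Struct Ag AtProp)
  /-- `X < Y` -/
  | lt (X Y : Struct Ag AtProp)
  /-- `{a}X` and its adjoint -/
  | ag (a : Ag) (X : Struct Ag AtProp)
  | agConv (a : Ag) (X : Struct Ag AtProp)
  /-- `{α}X` and its adjoint -/
  | act (α : Action Ag AtProp) (X : Struct Ag AtProp)
  | actConv (α : Action Ag AtProp) (X : Struct Ag AtProp)
  /-- `Φ_α` -/
  | phi (α : Action Ag AtProp)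

/-- Sequents `X ⊢ Y`. -/
structure Sequent (Ag : Type u) (AtProp : Type v) where
  left : Struct Ag AtProp
  right : Struct Ag AtProp

infix:40 " ⊢ₛ " => Sequent.mk

/-- Precedent and succedent position. -/
inductive Pos
  | prec
  | succ

section Semantics

variable {Ag : Type u} {AtProp : Type v}

/-! ## Semantics in the final coalgebra -/

/-- The extension `⟦A⟧_ℤ` of a D'.EAK-formula in the final coalgebra. -/
def Fm.ext : Fm Ag AtProp → Set (finalModel.{u, v, w} Ag AtProp).W
  | .atom p => (finalModel Ag AtProp).V p
  | .bot => ∅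
  | .top => Set.univ
  | .and A B => A.ext ∩ B.ext
  | .or A B => A.ext ∪ B.ext
  | .imp A B => A.extᶜ ∪ B.ext
  | .pmi B A => A.extᶜ ∪ B.ext
  | .rsub A B => B.ext \ A.ext
  | .lsub B A => B.ext \ A.ext
  | .agDia a A => fDia ((finalModel Ag AtProp).R a) A.ext
  | .agBox a A => fBox ((finalModel Ag AtProp).R a) A.ext
  | .agConvDia a A => pDia ((finalModel Ag AtProp).R a) A.ext
  | .agConvBox a A => pBox ((finalModel Ag AtProp).R a) A.ext
  | .actDia α A => fDia (actionRel α) A.ext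
  | .actBox α A => fBox (actionRel α) A.ext
  | .actConvDia α A => pDia (actionRel α) A.ext
  | .actConvBox α A => pBox (actionRel α) A.ext
  | .one α => α.pre.ext (finalModel Ag AtProp)

/-- Translation of structures into formulas according to their position. The constant `Φ_α` is
read as `1_α` in precedent position. It is not meant to be used in succedent position; there it
is read as the formula `post α`, where `post` is arbitrary. -/
def Struct.toFm (post : Action Ag AtProp → Fm Ag AtProp) :
    Pos → Struct Ag AtProp → Fm Ag AtProp
  | _, .fm A => A
  | .prec, .I => .top
  | .succ, .I => .bot
  | .prec, .semi X Y => .and (X.toFm post .prec) (Y.toFm post .prec)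
  | .succ, .semi X Y => .or (X.toFm post .succ) (Y.toFm post .succ)
  | .prec, .gt X Y => .rsub (X.toFm post .succ) (Y.toFm post .prec)
  | .succ, .gt X Y => .imp (X.toFm post .prec) (Y.toFm post .succ)
  | .prec, .lt X Y => .lsub (X.toFm post .prec) (Y.toFm post .succ)
  | .succ, .lt X Y => .pmi (X.toFm post .succ) (Y.toFm post .prec)
  | .prec, .ag a X => .agDia a (X.toFm post .prec)
  | .succ, .ag a X => .agBox a (X.toFm post .succ)
  | .prec, .agConv a X => .agConvDia a (X.toFm post .prec)
  | .succ, .agConv a X => .agConvBox a (X.toFm post .succ)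
  | .prec, .act α X => .actDia α (X.toFm post .prec)
  | .succ, .act α X => .actBox α (X.toFm post .succ)
  | .prec, .actConv α X => .actConvDia α (X.toFm post .prec)
  | .succ, .actConv α X => .actConvBox α (X.toFm post .succ)
  | .prec, .phi α => .one α
  | .succ, .phi α => post α

/-- A sequent `X ⊢ Y` holds in the final coalgebra (over models with carrier in `Type w`) iff
`⟦X⟧_ℤ ⊆ ⟦Y⟧_ℤ`. -/
def Sequent.Holds (post : Action Ag AtProp → Fm Ag AtProp) (s : Sequent Ag AtProp) : Prop :=
  Fm.ext.{u, v, w} (s.left.toFm post .prec) ⊆ Fm.ext.{u, v, w} (s.right.toFm post .succ)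

end Semantics

/-! ## The calculus D'.EAK -/

section Calculus

variable {Ag : Type u} {AtProp : Type v}

/-- One element of the sequences `Γ`, `Δ` of the rule *atom*: `{α}` or its adjoint. -/
inductive Step (Ag : Type u) (AtProp : Type v) : Type (max u v)
  | fwd (α : Action Ag AtProp)
  | bwd (α : Action Ag AtProp)

/-- Prefix a single proxy to a structure. -/
def Step.apply : Step Ag AtProp → Struct Ag AtProp → Struct Ag AtProp
  | .fwd α, X => .act α X
  | .bwd α, X => .actConv α X

/-- The structure `Γ X` for a finite sequence `Γ` of proxies. -/
def prefixed (Γ : List (Step Ag AtProp)) (X : Struct Ag AtProp) : Struct Ag AtProp :=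
  Γ.foldr Step.apply X

/-- The structure `(⋯(Y ; Y) ; ⋯ ; Y)` with `n` occurrences of `Y`; it is `I` for `n = 0`. -/
def semis (Y : Struct Ag AtProp) : ℕ → Struct Ag AtProp
  | 0 => .I
  | 1 => Y
  | n + 2 => .semi (semis Y (n + 1)) Y

/-- `;(Y | α a β)`, with as many occurrences of `Y` as there are actions `β` such that `α a β`. -/
noncomputable def semiSeen (α : Action Ag AtProp) (a : Ag) (Y : Struct Ag AtProp) :
    Struct Ag AtProp :=
  semis Y {β | α.Sees a β}.ncard

open Struct in
/-- The rules of D'.EAK: `Rule P s` says that `s` is the conclusion of an instance of a rule with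
set of premises `P`. The two directions of an invertible rule are marked `_down` and `_up`. -/
inductive Rule : Set (Sequent Ag AtProp) → Sequent Ag AtProp → Prop
  -- structural rules of the propositional base
  | id (p) : Rule ∅ (fm (.atom p) ⊢ₛ fm (.atom p))
  | cut (X Y A) : Rule {X ⊢ₛ fm A, fm A ⊢ₛ Y} (X ⊢ₛ Y)
  | I1L_down (X Y) : Rule {X ⊢ₛ Y} (I ⊢ₛ lt Y X)
  | I1L_up (X Y) : Rule {I ⊢ₛ lt Y X} (X ⊢ₛ Y)
  | I1R_down (X Y) : Rule {X ⊢ₛ Y} (lt X Y ⊢ₛ I)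
  | I1R_up (X Y) : Rule {lt X Y ⊢ₛ I} (X ⊢ₛ Y)
  | I2L_down (X Y) : Rule {X ⊢ₛ Y} (I ⊢ₛ gt X Y)
  | I2L_up (X Y) : Rule {I ⊢ₛ gt X Y} (X ⊢ₛ Y)
  | I2R_down (X Y) : Rule {X ⊢ₛ Y} (gt Y X ⊢ₛ I)
  | I2R_up (X Y) : Rule {gt Y X ⊢ₛ I} (X ⊢ₛ Y)
  | IWL (X Y) : Rule {I ⊢ₛ X} (Y ⊢ₛ X)
  | IWR (X Y) : Rule {X ⊢ₛ I} (X ⊢ₛ Y)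
  | W1L (X Y Z) : Rule {X ⊢ₛ Z} (Y ⊢ₛ lt Z X)
  | W1R (X Y Z) : Rule {X ⊢ₛ Z} (lt X Z ⊢ₛ Y)
  | W2L (X Y Z) : Rule {X ⊢ₛ Z} (Y ⊢ₛ gt X Z)
  | W2R (X Y Z) : Rule {X ⊢ₛ Z} (gt Z X ⊢ₛ Y)
  | CL (X Y) : Rule {semi X X ⊢ₛ Y} (X ⊢ₛ Y)
  | CR (X Y) : Rule {Y ⊢ₛ semi X X} (Y ⊢ₛ X)
  | EL (X Y Z) : Rule {semi Y X ⊢ₛ Z} (semi X Y ⊢ₛ Z)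
  | ER (X Y Z) : Rule {Z ⊢ₛ semi X Y} (Z ⊢ₛ semi Y X)
  | AL (X Y Z W) : Rule {semi X (semi Y Z) ⊢ₛ W} (semi (semi X Y) Z ⊢ₛ W)
  | AR (X Y Z W) : Rule {W ⊢ₛ semi (semi Z Y) X} (W ⊢ₛ semi Z (semi Y X))
  -- display postulates of the propositional base
  | semi_lt_down (X Y Z) : Rule {semi X Y ⊢ₛ Z} (X ⊢ₛ lt Z Y)
  | semi_lt_up (X Y Z) : Rule {X ⊢ₛ lt Z Y} (semi X Y ⊢ₛ Z)
  | lt_semi_down (X Y Z) : Rule {Z ⊢ₛ semi X Y} (lt Z Y ⊢ₛ X)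
  | lt_semi_up (X Y Z) : Rule {lt Z Y ⊢ₛ X} (Z ⊢ₛ semi X Y)
  | semi_gt_down (X Y Z) : Rule {semi X Y ⊢ₛ Z} (Y ⊢ₛ gt X Z)
  | semi_gt_up (X Y Z) : Rule {Y ⊢ₛ gt X Z} (semi X Y ⊢ₛ Z)
  | gt_semi_down (X Y Z) : Rule {Z ⊢ₛ semi X Y} (gt X Z ⊢ₛ Y)
  | gt_semi_up (X Y Z) : Rule {gt X Z ⊢ₛ Y} (Z ⊢ₛ semi X Y)
  -- Grishin rules
  | griL_down (X Y Z W) : Rule {gt X (semi Y Z) ⊢ₛ W} (semi (gt X Y) Z ⊢ₛ W)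
  | griL_up (X Y Z W) : Rule {semi (gt X Y) Z ⊢ₛ W} (gt X (semi Y Z) ⊢ₛ W)
  | griR_down (X Y Z W) : Rule {W ⊢ₛ gt X (semi Y Z)} (W ⊢ₛ semi (gt X Y) Z)
  | griR_up (X Y Z W) : Rule {W ⊢ₛ semi (gt X Y) Z} (W ⊢ₛ gt X (semi Y Z))
  -- operational rules of the propositional base
  | botL : Rule ∅ (fm .bot ⊢ₛ I)
  | botR (X) : Rule {X ⊢ₛ I} (X ⊢ₛ fm .bot)
  | topL (X) : Rule {I ⊢ₛ X} (fm .top ⊢ₛ X)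
  | topR : Rule ∅ (I ⊢ₛ fm .top)
  | andL (A B Z) : Rule {semi (fm A) (fm B) ⊢ₛ Z} (fm (.and A B) ⊢ₛ Z)
  | andR (A B X Y) : Rule {X ⊢ₛ fm A, Y ⊢ₛ fm B} (semi X Y ⊢ₛ fm (.and A B))
  | orL (A B X Y) : Rule {fm A ⊢ₛ X, fm B ⊢ₛ Y} (fm (.or A B) ⊢ₛ semi X Y)
  | orR (A B Z) : Rule {Z ⊢ₛ semi (fm A) (fm B)} (Z ⊢ₛ fm (.or A B))
  | pmiL (A B X Y) : Rule {fm B ⊢ₛ Y, X ⊢ₛ fm A} (fm (.pmi B A) ⊢ₛ lt Y X)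
  | pmiR (A B Z) : Rule {Z ⊢ₛ lt (fm B) (fm A)} (Z ⊢ₛ fm (.pmi B A))
  | lsubL (A B Z) : Rule {lt (fm B) (fm A) ⊢ₛ Z} (fm (.lsub B A) ⊢ₛ Z)
  | lsubR (A B X Y) : Rule {Y ⊢ₛ fm B, fm A ⊢ₛ X} (lt Y X ⊢ₛ fm (.lsub B A))
  | impL (A B X Y) : Rule {X ⊢ₛ fm A, fm B ⊢ₛ Y} (fm (.imp A B) ⊢ₛ gt X Y)
  | impR (A B Z) : Rule {Z ⊢ₛ gt (fm A) (fm B)} (Z ⊢ₛ fm (.imp A B))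
  | rsubL (A B Z) : Rule {gt (fm A) (fm B) ⊢ₛ Z} (fm (.rsub A B) ⊢ₛ Z)
  | rsubR (A B X Y) : Rule {fm A ⊢ₛ X, Y ⊢ₛ fm B} (gt X Y ⊢ₛ fm (.rsub A B))
  -- structural rules of the epistemic modalities
  | ag_necL (a X) : Rule {I ⊢ₛ X} (ag a I ⊢ₛ X)
  | ag_necR (a X) : Rule {X ⊢ₛ I} (X ⊢ₛ ag a I)
  | agConv_necL (a X) : Rule {I ⊢ₛ X} (agConv a I ⊢ₛ X)
  | agConv_necR (a X) : Rule {X ⊢ₛ I} (X ⊢ₛ agConv a I)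
  | ag_FSL (a X Y Z) : Rule {gt (ag a Y) (ag a Z) ⊢ₛ X} (ag a (gt Y Z) ⊢ₛ X)
  | ag_FSR (a X Y Z) : Rule {Y ⊢ₛ gt (ag a X) (ag a Z)} (Y ⊢ₛ ag a (gt X Z))
  | ag_monL (a X Y Z) : Rule {semi (ag a X) (ag a Y) ⊢ₛ Z} (ag a (semi X Y) ⊢ₛ Z)
  | ag_monR (a X Y Z) : Rule {Z ⊢ₛ semi (ag a Y) (ag a X)} (Z ⊢ₛ ag a (semi Y X))
  | agConv_FSL (a X Y Z) :
      Rule {gt (agConv a Y) (agConv a X) ⊢ₛ Z} (agConv a (gt Y X) ⊢ₛ Z)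
  | agConv_FSR (a X Y Z) :
      Rule {Y ⊢ₛ gt (agConv a X) (agConv a Z)} (Y ⊢ₛ agConv a (gt X Z))
  | agConv_monL (a X Y Z) :
      Rule {semi (agConv a X) (agConv a Y) ⊢ₛ Z} (agConv a (semi X Y) ⊢ₛ Z)
  | agConv_monR (a X Y Z) :
      Rule {Z ⊢ₛ semi (agConv a Y) (agConv a X)} (Z ⊢ₛ agConv a (semi Y X))
  -- display postulates of the epistemic modalities
  | ag_agConv_down (a X Y) : Rule {ag a X ⊢ₛ Y} (X ⊢ₛ agConv a Y)
  | ag_agConv_up (a X Y) : Rule {X ⊢ₛ agConv a Y} (ag a X ⊢ₛ Y)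
  | agConv_ag_down (a X Y) : Rule {X ⊢ₛ ag a Y} (agConv a X ⊢ₛ Y)
  | agConv_ag_up (a X Y) : Rule {agConv a X ⊢ₛ Y} (X ⊢ₛ ag a Y)
  -- operational rules of the epistemic modalities
  | agDiaL (a A X) : Rule {ag a (fm A) ⊢ₛ X} (fm (.agDia a A) ⊢ₛ X)
  | agDiaR (a A X) : Rule {X ⊢ₛ fm A} (ag a X ⊢ₛ fm (.agDia a A))
  | agBoxL (a A X) : Rule {fm A ⊢ₛ X} (fm (.agBox a A) ⊢ₛ ag a X)
  | agBoxR (a A X) : Rule {X ⊢ₛ ag a (fm A)} (X ⊢ₛ fm (.agBox a A))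
  | agConvDiaL (a A X) : Rule {agConv a (fm A) ⊢ₛ X} (fm (.agConvDia a A) ⊢ₛ X)
  | agConvDiaR (a A X) : Rule {X ⊢ₛ fm A} (agConv a X ⊢ₛ fm (.agConvDia a A))
  | agConvBoxL (a A X) : Rule {fm A ⊢ₛ X} (fm (.agConvBox a A) ⊢ₛ agConv a X)
  | agConvBoxR (a A X) : Rule {X ⊢ₛ agConv a (fm A)} (X ⊢ₛ fm (.agConvBox a A))
  -- structural rules of the dynamic modalities
  | act_necL (α X) : Rule {I ⊢ₛ X} (act α I ⊢ₛ X)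
  | act_necR (α X) : Rule {X ⊢ₛ I} (X ⊢ₛ act α I)
  | actConv_necL (α X) : Rule {I ⊢ₛ X} (actConv α I ⊢ₛ X)
  | actConv_necR (α X) : Rule {X ⊢ₛ I} (X ⊢ₛ actConv α I)
  | act_FSL (α X Y Z) : Rule {gt (act α Y) (act α Z) ⊢ₛ X} (act α (gt Y Z) ⊢ₛ X)
  | act_FSR (α X Y Z) : Rule {Y ⊢ₛ gt (act α X) (act α Z)} (Y ⊢ₛ act α (gt X Z))
  | act_monL (α X Y Z) : Rule {semi (act α X) (act α Y) ⊢ₛ Z} (act α (semi X Y) ⊢ₛ Z)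
  | act_monR (α X Y Z) : Rule {Z ⊢ₛ semi (act α Y) (act α X)} (Z ⊢ₛ act α (semi Y X))
  | actConv_FSL (α X Y Z) :
      Rule {gt (actConv α Y) (actConv α X) ⊢ₛ Z} (actConv α (gt Y X) ⊢ₛ Z)
  | actConv_FSR (α X Y Z) :
      Rule {Y ⊢ₛ gt (actConv α X) (actConv α Z)} (Y ⊢ₛ actConv α (gt X Z))
  | actConv_monL (α X Y Z) :
      Rule {semi (actConv α X) (actConv α Y) ⊢ₛ Z} (actConv α (semi X Y) ⊢ₛ Z)
  | actConv_monR (α X Y Z) :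
      Rule {Z ⊢ₛ semi (actConv α Y) (actConv α X)} (Z ⊢ₛ actConv α (semi Y X))
  -- display postulates of the dynamic modalities
  | act_actConv_down (α X Y) : Rule {act α X ⊢ₛ Y} (X ⊢ₛ actConv α Y)
  | act_actConv_up (α X Y) : Rule {X ⊢ₛ actConv α Y} (act α X ⊢ₛ Y)
  | actConv_act_down (α X Y) : Rule {Y ⊢ₛ act α X} (actConv α Y ⊢ₛ X)
  | actConv_act_up (α X Y) : Rule {actConv α Y ⊢ₛ X} (Y ⊢ₛ act α X)
  -- rules for epistemic actions
  | atom (Γ Δ p) : Rule ∅ (prefixed Γ (fm (.atom p)) ⊢ₛ prefixed Δ (fm (.atom p)))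
  | balance (α X Y) : Rule {X ⊢ₛ Y} (act α X ⊢ₛ act α Y)
  | compL (α X Y) : Rule {act α (actConv α X) ⊢ₛ Y} (semi (phi α) X ⊢ₛ Y)
  | compR (α X Y) : Rule {X ⊢ₛ act α (actConv α Y)} (X ⊢ₛ gt (phi α) Y)
  | reduceL (α X Y) : Rule {semi (phi α) (act α X) ⊢ₛ Y} (act α X ⊢ₛ Y)
  | reduceR (α X Y) : Rule {Y ⊢ₛ gt (phi α) (act α X)} (Y ⊢ₛ act α X)
  | swapInL (α β a X Y) (h : α.Sees a β) :
      Rule {act α (ag a X) ⊢ₛ Y} (semi (phi α) (ag a (act β X)) ⊢ₛ Y)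
  | swapInR (α β a X Y) (h : α.Sees a β) :
      Rule {Y ⊢ₛ act α (ag a X)} (Y ⊢ₛ gt (phi α) (ag a (act β X)))
  | swapOutL (α a X Y) :
      Rule {s | ∃ β, α.Sees a β ∧ s = (ag a (act β X) ⊢ₛ Y)}
        (act α (ag a X) ⊢ₛ semiSeen α a Y)
  | swapOutR (α a X Y) :
      Rule {s | ∃ β, α.Sees a β ∧ s = (Y ⊢ₛ ag a (act β X))}
        (semiSeen α a Y ⊢ₛ act α (ag a X))
  -- operational rules of the dynamic modalities and of `1_α`
  | actDiaL (α A X) : Rule {act α (fm A) ⊢ₛ X} (fm (.actDia α A) ⊢ₛ X)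
  | actDiaR (α A X) : Rule {X ⊢ₛ fm A} (act α X ⊢ₛ fm (.actDia α A))
  | actBoxL (α A X) : Rule {fm A ⊢ₛ X} (fm (.actBox α A) ⊢ₛ act α X)
  | actBoxR (α A X) : Rule {X ⊢ₛ act α (fm A)} (X ⊢ₛ fm (.actBox α A))
  | actConvDiaL (α A X) : Rule {actConv α (fm A) ⊢ₛ X} (fm (.actConvDia α A) ⊢ₛ X)
  | actConvDiaR (α A X) : Rule {X ⊢ₛ fm A} (actConv α X ⊢ₛ fm (.actConvDia α A))
  | actConvBoxL (α A X) : Rule {fm A ⊢ₛ X} (fm (.actConvBox α A) ⊢ₛ actConv α X)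
  | actConvBoxR (α A X) : Rule {X ⊢ₛ actConv α (fm A)} (X ⊢ₛ fm (.actConvBox α A))
  | oneL (α X) : Rule {phi α ⊢ₛ X} (fm (.one α) ⊢ₛ X)
  | oneR (α) : Rule ∅ (phi α ⊢ₛ fm (.one α))

/-- Derivability in D'.EAK. -/
inductive Derivable : Sequent Ag AtProp → Prop
  | step {P : Set (Sequent Ag AtProp)} {s : Sequent Ag AtProp} :
      Rule P s → (∀ t ∈ P, Derivable t) → Derivable s

end Calculus

end EAK

-- Most rules hold for purely relational reasons: the propositional ones are Boolean, and the
-- necessitation, Fischer Servi, monotonicity, display and operational rules for a modality are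
-- valid for the diamond and box of any relation together with those of its converse. Each `Φ_α`
-- displayed in a rule is in precedent position, and a structure variable shared by premises and
-- conclusion keeps its position. The reading `post` of `Φ_α` in succedent position therefore plays
-- no role.
--
-- Only the rules for epistemic actions use the nature of `α_ℤ`. They rest on four facts. It is a
-- partial function (*balance*); its domain is the extension of `Pre(α)` (*comp*, *reduce'*); it
-- preserves the valuation (*atom*); and it commutes with the agents: after `α`, the agent `a`
-- reaches exactly what is reached by an `a`-step followed by some `β` with `α a β` (*swap-in'*,
-- *swap-out'*; the passage from right to left needs `Pre(α)`).
--
-- A witness for `z α_ℤ z'` lives in some representing model, and two witnesses may use different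
-- models. They become comparable because EAK-formulas are bisimulation invariant and a bisimulation
-- lifts to the updates. These two statements depend on each other: the domain of an update is cut
-- out by formulas, and the truth of `⟨α⟩A` is decided in an update.

namespace EAK

-- Bisimulation invariance of EAK-formulas and of updates

section Invariance

variable {Ag : Type u} {AtProp : Type v}

/-- A bisimulation lifts to products restricted to corresponding families of subsets. -/
theorem IsBisimulation.product {M : Model.{u, v, w} Ag AtProp} {N : Model.{u, v, w'} Ag AtProp}
    {B : M.W → N.W → Prop} (hB : IsBisimulation M N B) {n : ℕ} (r : Ag → Fin n → Fin n → Prop)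
    {S : Fin n → Set M.W} {T : Fin n → Set N.W}
    (hST : ∀ j x y, B x y → (x ∈ S j ↔ y ∈ T j)) :
    IsBisimulation (M.product r S) (N.product r T)
      (fun x y => B x.1.1 y.1.1 ∧ x.1.2 = y.1.2) where
  atom x y h p := hB.atom _ _ h.1 p
  forth := by
    rintro ⟨⟨x, i⟩, hx⟩ ⟨⟨y, _⟩, hy⟩ ⟨hxy, rfl⟩ a ⟨⟨x', j⟩, hx'⟩ ⟨hR, hr⟩
    obtain ⟨y', hy', hb⟩ := hB.forth _ _ hxy a x' hR
    exact ⟨⟨(y', j), (hST j x' y' hb).1 hx'⟩, ⟨hy', hr⟩, hb, rfl⟩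
  back := by
    rintro ⟨⟨x, i⟩, hx⟩ ⟨⟨y, _⟩, hy⟩ ⟨hxy, rfl⟩ a ⟨⟨y', j⟩, hy'⟩ ⟨hR, hr⟩
    obtain ⟨x', hx', hb⟩ := hB.back _ _ hxy a y' hR
    exact ⟨⟨(x', j), (hST j x' y' hb).2 hy'⟩, ⟨hx', hr⟩, hb, rfl⟩

/-- Bisimilar points satisfy the same EAK-formulas. -/
theorem Formula.mem_ext_iff_of_bisimulation :
    (A : Formula Ag AtProp) → ∀ {M : Model.{u, v, w} Ag AtProp} {N : Model.{u, v, w'} Ag AtProp}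
      {B : M.W → N.W → Prop}, IsBisimulation M N B → ∀ {x y}, B x y →
      (x ∈ A.ext M ↔ y ∈ A.ext N)
  | .atom p, M, N, B, hB, x, y, h => by
    simpa only [Formula.ext] using hB.atom x y h p
  | .neg A, M, N, B, hB, x, y, h => by
    simpa only [Formula.ext, Set.mem_compl_iff] using
      not_congr (A.mem_ext_iff_of_bisimulation hB h)
  | .or A A', M, N, B, hB, x, y, h => by
    simpa only [Formula.ext, Set.mem_union] using
      or_congr (A.mem_ext_iff_of_bisimulation hB h) (A'.mem_ext_iff_of_bisimulation hB h)
  | .dia a A, M, N, B, hB, x, y, h => by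
    simp only [Formula.ext, Set.mem_ofPred_eq]
    constructor
    · rintro ⟨x', hx', hA⟩
      obtain ⟨y', hy', hb⟩ := hB.forth x y h a x' hx'
      exact ⟨y', hy', (A.mem_ext_iff_of_bisimulation hB hb).1 hA⟩
    · rintro ⟨y', hy', hA⟩
      obtain ⟨x', hx', hb⟩ := hB.back x y h a y' hy'
      exact ⟨x', hx', (A.mem_ext_iff_of_bisimulation hB hb).2 hA⟩
  | .act (.mk n k r pre) A, M, N, B, hB, x, y, h => by
    -- Invariance of the preconditions, which are structurally smaller than `⟨α⟩A`, makes the two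
    -- update domains correspond. The recursive call on `A` is then made for the updated models and
    -- the lifted bisimulation, which is why the models and `B` are quantified after the formula.
    have hpre : ∀ j x y, B x y → (x ∈ (pre j).ext M ↔ y ∈ (pre j).ext N) :=
      fun j x y h => (pre j).mem_ext_iff_of_bisimulation hB h
    have hprod := hB.product r hpre
    simp only [Formula.ext, Set.mem_ofPred_eq]
    constructor
    · rintro ⟨hx, hA⟩
      exact ⟨(hpre k x y h).1 hx, (A.mem_ext_iff_of_bisimulation hprod ⟨h, rfl⟩).1 hA⟩
    · rintro ⟨hy, hA⟩
      exact ⟨(hpre k x y h).2 hy, (A.mem_ext_iff_of_bisimulation hprod ⟨h, rfl⟩).2 hA⟩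

/-- The graph of a coalgebra morphism is a bisimulation. -/
theorem IsMorphism.isBisimulation {M : Model.{u, v, w} Ag AtProp}
    {N : Model.{u, v, w'} Ag AtProp} {f : M.W → N.W} (hf : IsMorphism M N f) :
    IsBisimulation M N (fun x y => f x = y) where
  atom := by rintro x _ rfl p; exact hf.atom x p
  forth := by rintro x _ rfl a x' h; exact ⟨f x', hf.forth x a x' h, rfl⟩
  back := by rintro x _ rfl a y h; exact hf.back x a y h

/-- Every model satisfies a formula at a point iff the final coalgebra does at its image. -/
theorem beh_mem_ext_iff (A : Formula Ag AtProp) {M : Model.{u, v, w} Ag AtProp} {x : M.W} :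
    beh M x ∈ A.ext (finalModel.{u, v, w} Ag AtProp) ↔ x ∈ A.ext M :=
  (A.mem_ext_iff_of_bisimulation (beh_isMorphism M).isBisimulation rfl).symm

/-- Updating behaviourally equivalent points gives behaviourally equivalent points. -/
theorem beh_update_congr (α : Action Ag AtProp) {M N : Model.{u, v, w} Ag AtProp}
    {x : M.W} {y : N.W} (h : beh M x = beh N y) (i : Fin α.size)
    (hx : x ∈ (α.preAt i).ext M) (hy : y ∈ (α.preAt i).ext N) :
    beh (M.update α) ⟨(x, i), hx⟩ = beh (N.update α) ⟨(y, i), hy⟩ := by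
  obtain ⟨B, hB, hb⟩ := beh_eq_iff.1 h
  exact beh_eq_iff.2 ⟨_, hB.product α.rel
    fun j x y h => (α.preAt j).mem_ext_iff_of_bisimulation hB h, hb, rfl⟩

end Invariance

-- The relation `α_ℤ`: functionality, domain, valuation, commutation with agents

section ActionRel

variable {Ag : Type u} {AtProp : Type v} {α β : Action Ag AtProp} {a : Ag}
  {z z' z'' : FinalCarrier.{u, v, w} Ag AtProp}

/-- The interpretation of an action is a partial function. -/
theorem actionRel_unique (h : actionRel α z z') (h' : actionRel α z z'') : z' = z'' := by
  obtain ⟨M, x, hx, rfl, rfl⟩ := h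
  obtain ⟨N, y, hy, e, rfl⟩ := h'
  exact beh_update_congr α e.symm α.point hx hy

/-- The domain of the interpretation of an action is the extension of its precondition. -/
theorem exists_actionRel_iff :
    (∃ z', actionRel α z z') ↔ z ∈ α.pre.ext (finalModel.{u, v, w} Ag AtProp) := by
  constructor
  · rintro ⟨_, M, x, hx, rfl, rfl⟩
    exact (beh_mem_ext_iff _).2 hx
  · obtain ⟨⟨M, x⟩, rfl⟩ := Quotient.exists_rep z
    exact fun h => ⟨_, M, x, (beh_mem_ext_iff _).1 h, rfl, rfl⟩

/-- Actions do not change the valuation. -/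
theorem actionRel_mem_V_iff (h : actionRel α z z') (p : AtProp) :
    z ∈ (finalModel.{u, v, w} Ag AtProp).V p ↔ z' ∈ (finalModel.{u, v, w} Ag AtProp).V p := by
  obtain ⟨M, x, hx, rfl, rfl⟩ := h
  exact ((beh_isMorphism M).atom x p).symm.trans
    ((beh_isMorphism (M.update α)).atom ⟨(x, α.point), hx⟩ p)

/-- A step of an agent followed by an action that the agent considers possible can be performed
after the actual action, if the latter is executable. -/
theorem exists_actionRel_R_of_sees (hs : α.Sees a β)
    (hz : z ∈ α.pre.ext (finalModel.{u, v, w} Ag AtProp))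
    (hR : (finalModel.{u, v, w} Ag AtProp).R a z z') (hβ : actionRel β z' z'') :
    ∃ y, actionRel α z y ∧ (finalModel.{u, v, w} Ag AtProp).R a y z'' := by
  obtain ⟨i, hi, rfl⟩ := hs
  obtain ⟨⟨M, x⟩, rfl⟩ := Quotient.exists_rep z
  -- The `a`-step in `ℤ` lifts to the chosen model `M`. The execution of `β` comes with its own
  -- model `N`, whose point `y` is only bisimilar to `x'`.
  obtain ⟨x', hx', rfl⟩ := (beh_isMorphism M).back x a z' hR
  obtain ⟨N, y, hy, e, rfl⟩ := hβ
  have hx : x ∈ α.pre.ext M := (beh_mem_ext_iff _).1 hz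
  have hpre' : x' ∈ (α.preAt i).ext M :=
    (beh_mem_ext_iff _).1 (e ▸ (beh_mem_ext_iff _).2 hy)
  refine ⟨beh (M.update α) ⟨(x, α.point), hx⟩, ⟨M, x, hx, rfl, rfl⟩, ?_⟩
  refine ⟨M.update α, ⟨(x, α.point), hx⟩, ⟨(x', i), hpre'⟩, ⟨hx', hi⟩, rfl, ?_⟩
  -- `α` and `α_i` differ only in the designated state, so the updates by them are the same model,
  -- and executing `β = α_i` at `y` leads to the point `(y, i)` of `N^α`.
  exact beh_update_congr α e.symm i hpre' hy

/-- A step of an agent after an action arises from a step before the action, followed by an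
action that the agent considers possible. -/
theorem exists_sees_of_actionRel_R (hα : actionRel α z z')
    (hR : (finalModel.{u, v, w} Ag AtProp).R a z' z'') :
    ∃ β, α.Sees a β ∧ ∃ y, (finalModel.{u, v, w} Ag AtProp).R a z y ∧ actionRel β y z'' := by
  obtain ⟨M, x, hx, rfl, rfl⟩ := hα
  -- The step lifts to `M^α`, where every step is a step of `M` paired with a step of `α`; the
  -- second component determines `β = α_i`.
  obtain ⟨⟨⟨x', i⟩, hx'⟩, ⟨hR', hi⟩, rfl⟩ := (beh_isMorphism (M.update α)).back _ a z'' hR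
  exact ⟨α.withPoint i, ⟨i, hi, rfl⟩, beh M x', (beh_isMorphism M).forth x a x' hR',
    M, x', hx', rfl, rfl⟩

/-- An action has finitely many alternatives. -/
theorem Action.finite_sees (α : Action Ag AtProp) (a : Ag) : {β | α.Sees a β}.Finite :=
  (Set.finite_range α.withPoint).subset fun _ ⟨i, _, h⟩ => ⟨i, h.symm⟩

end ActionRel

-- Repeated `;` and prefixes of action proxies

section Structures

variable {Ag : Type u} {AtProp : Type v} (post : Action Ag AtProp → Fm Ag AtProp)

/-- Intersection is idempotent. The case `n = 0` has to be excluded, since `I` is then read as `⊤`.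
-/
theorem ext_semis_prec (Y : Struct Ag AtProp) : ∀ {n : ℕ}, n ≠ 0 →
    Fm.ext.{u, v, w} ((semis Y n).toFm post .prec) = Fm.ext.{u, v, w} (Y.toFm post .prec)
  | 1, _ => by rw [semis]
  | n + 2, _ => by
    rw [semis, Struct.toFm, Fm.ext, ext_semis_prec Y n.succ_ne_zero, Set.inter_self]

theorem ext_semis_succ (Y : Struct Ag AtProp) : ∀ {n : ℕ}, n ≠ 0 →
    Fm.ext.{u, v, w} ((semis Y n).toFm post .succ) = Fm.ext.{u, v, w} (Y.toFm post .succ)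
  | 1, _ => by rw [semis]
  | n + 2, _ => by
    rw [semis, Struct.toFm, Fm.ext, ext_semis_succ Y n.succ_ne_zero, Set.union_self]

/-- A single visible `β` makes the number of copies positive. Finiteness matters because `Set.ncard`
is `0` on infinite sets. -/
theorem ext_semiSeen_prec {α β : Action Ag AtProp} {a : Ag} (h : α.Sees a β)
    (Y : Struct Ag AtProp) :
    Fm.ext.{u, v, w} ((semiSeen α a Y).toFm post .prec) =
      Fm.ext.{u, v, w} (Y.toFm post .prec) :=
  ext_semis_prec post Y (Set.ncard_ne_zero_of_mem h (α.finite_sees a))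

theorem ext_semiSeen_succ {α β : Action Ag AtProp} {a : Ag} (h : α.Sees a β)
    (Y : Struct Ag AtProp) :
    Fm.ext.{u, v, w} ((semiSeen α a Y).toFm post .succ) =
      Fm.ext.{u, v, w} (Y.toFm post .succ) :=
  ext_semis_succ post Y (Set.ncard_ne_zero_of_mem h (α.finite_sees a))

/-- In precedent position each proxy is a diamond along `α_ℤ` or its converse, and the valuation is
unchanged in both directions. -/
theorem ext_prefixed_atom_prec (p : AtProp) : ∀ Γ : List (Step Ag AtProp),
    Fm.ext.{u, v, w} ((prefixed Γ (.fm (.atom p))).toFm post .prec) ⊆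
      (finalModel.{u, v, w} Ag AtProp).V p
  | [] => by simp only [prefixed, List.foldr_nil, Struct.toFm, Fm.ext, subset_refl]
  | .fwd _ :: Γ => fun _ ⟨_, h, hz⟩ =>
    (actionRel_mem_V_iff h p).2 (ext_prefixed_atom_prec p Γ hz)
  | .bwd _ :: Γ => fun _ ⟨_, h, hz⟩ =>
    (actionRel_mem_V_iff h p).1 (ext_prefixed_atom_prec p Γ hz)

/-- Dually, each proxy is now a box: any successor agrees with the given point on `p`. -/
theorem ext_prefixed_atom_succ (p : AtProp) : ∀ Δ : List (Step Ag AtProp),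
    (finalModel.{u, v, w} Ag AtProp).V p ⊆
      Fm.ext.{u, v, w} ((prefixed Δ (.fm (.atom p))).toFm post .succ)
  | [] => by simp only [prefixed, List.foldr_nil, Struct.toFm, Fm.ext, subset_refl]
  | .fwd _ :: Δ => fun _ hz _ h =>
    ext_prefixed_atom_succ p Δ ((actionRel_mem_V_iff h p).1 hz)
  | .bwd _ :: Δ => fun _ hz _ h =>
    ext_prefixed_atom_succ p Δ ((actionRel_mem_V_iff h p).2 hz)

end Structures

-- Soundness of the rules

section Soundness

variable {Ag : Type u} {AtProp : Type v}

/-- Every rule preserves validity in the final coalgebra. -/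
theorem Rule.sound (post : Action Ag AtProp → Fm Ag AtProp) {P : Set (Sequent Ag AtProp)}
    {s : Sequent Ag AtProp} (h : Rule P s) (hP : ∀ t ∈ P, Sequent.Holds.{u, v, w} post t) :
    Sequent.Holds.{u, v, w} post s := by
  cases h
  case atom Γ Δ p =>
    exact (ext_prefixed_atom_prec post p Γ).trans (ext_prefixed_atom_succ post p Δ)
  case swapOutL α a X Y =>
    rintro z ⟨z', hα, z'', hR, hX⟩
    -- The path through `α` and then `a` itself supplies a `β`. With no such `β` the left-hand side
    -- is empty, so the conclusion with `I` on the right is still valid.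
    obtain ⟨β, hβ, y, hy, hyz⟩ := exists_sees_of_actionRel_R hα hR
    change z ∈ Fm.ext ((semiSeen α a Y).toFm post .succ)
    rw [ext_semiSeen_succ post hβ]
    exact hP _ ⟨β, hβ, rfl⟩ ⟨y, hy, z'', hyz, hX⟩
  case swapOutR α a X Y =>
    intro z hz z' hα z'' hR
    obtain ⟨β, hβ, y, hy, hyz⟩ := exists_sees_of_actionRel_R hα hR
    change z ∈ Fm.ext ((semiSeen α a Y).toFm post .prec) at hz
    rw [ext_semiSeen_prec post hβ] at hz
    exact hP _ ⟨β, hβ, rfl⟩ hz y hy z'' hyz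
  case swapInL α β a X Y hs =>
    rintro z ⟨hz, z', hR, z'', hβ, hX⟩
    obtain ⟨y, hy, hyz⟩ := exists_actionRel_R_of_sees hs hz hR hβ
    exact hP _ rfl ⟨y, hy, z'', hyz, hX⟩
  case swapInR α β a X Y hs =>
    intro z hY
    -- `Φ_α > _` reads as an implication, hence as a union with the complement of `Pre(α)`; only
    -- points satisfying `Pre(α)` matter.
    refine or_iff_not_imp_left.2 fun hz z' hR z'' hβ => ?_
    obtain ⟨y, hy, hyz⟩ := exists_actionRel_R_of_sees hs (not_not.1 hz) hR hβ
    exact hP _ rfl hY y hy z'' hyz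
  case balance α X Y =>
    rintro z ⟨z', h, hX⟩ z'' h'
    -- For a partial function the diamond is contained in the box.
    exact actionRel_unique h h' ▸ hP _ rfl hX
  case compL α X Y =>
    rintro z ⟨hz, hX⟩
    obtain ⟨z', h⟩ := exists_actionRel_iff.2 hz
    -- Go along `α_ℤ` to `z'` and return to `z` itself.
    exact hP _ rfl ⟨z', h, z, h, hX⟩
  case compR α X Y =>
    intro z hX
    refine or_iff_not_imp_left.2 fun hz => ?_
    obtain ⟨z', h⟩ := exists_actionRel_iff.2 (not_not.1 hz)
    exact hP _ rfl hX z' h z h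
  case reduceL α X Y =>
    rintro z ⟨z', h, hX⟩
    exact hP _ rfl ⟨exists_actionRel_iff.1 ⟨z', h⟩, z', h, hX⟩
  case reduceR α X Y =>
    intro z hY z' h
    exact (hP _ rfl hY).resolve_left (not_not.2 (exists_actionRel_iff.1 ⟨z', h⟩)) z' h
  case ag_monR a X Y Z =>
    exact fun z hz y hy => (hP _ rfl hz).imp (fun h => h y hy) (fun h => h y hy)
  case agConv_monR a X Y Z =>
    exact fun z hz y hy => (hP _ rfl hz).imp (fun h => h y hy) (fun h => h y hy)
  -- In the remaining rules `R_a` and `α_ℤ` could be arbitrary relations; once the readings are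
  -- unfolded, each is a first-order statement about membership.
  all_goals
    simp only [Set.mem_insert_iff, Set.mem_singleton_iff, Set.mem_empty_iff_false, forall_eq_or_imp,
      forall_eq, Sequent.Holds, Struct.toFm, Fm.ext, Set.subset_def, fDia, fBox, pDia, pBox,
      Set.mem_ofPred_eq, Set.mem_inter_iff, Set.mem_union, Set.mem_sdiff, Set.mem_compl_iff,
      Set.mem_univ] at hP ⊢
    grind

/-- Every derivable sequent holds in the final coalgebra. -/
theorem Derivable.holds (post : Action Ag AtProp → Fm Ag AtProp) {s : Sequent Ag AtProp}
    (h : Derivable s) : Sequent.Holds.{u, v, w} post s := by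
  induction h with
  | step hr _ ih => exact hr.sound post ih

end Soundness

end EAK

theorem mainTheorem3 {Ag : Type u} {AtProp : Type v}
    (post : EAK.Action Ag AtProp → EAK.Fm Ag AtProp) :
    (∀ (P : Set (EAK.Sequent Ag AtProp)) (s : EAK.Sequent Ag AtProp), EAK.Rule P s →
      (∀ t ∈ P, EAK.Sequent.Holds.{u, v, w} post t) → EAK.Sequent.Holds.{u, v, w} post s) ∧
    (∀ s : EAK.Sequent Ag AtProp, EAK.Derivable s → EAK.Sequent.Holds.{u, v, w} post s) :=
  ⟨fun _ _ h => h.sound post, fun _ h => h.holds post⟩
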